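/- All algebraic structures are commutative. A \emph{semiring} is a non-empty set $S$ with two commutative and associative operations $+$ and $\cdot$ such that $\cdot$ distributes over $+$ (no additive or multiplicative neutral element is required; a \emph{unit} is a multiplicatively neutral element). It is \emph{finitely generated} if it is generated, as a semiring, by a finite subset. It is \emph{additively idempotent} if $a+a=a$ for all $a\in S$, and \emph{additively divisible} (resp. \emph{additively uniquely divisible}) if for every $a\in S$ and every integer $n\ge 1$ there is a (resp. exactly one) $b\in S$ with $a=nb=b+\dots+b$ ($n$ summands). A \emph{parasemifield} is a semiring whose multiplicative semigroup is a non-trivial group; $\mathbb{Q}^{+}$ is the parasemifield of positive rationals. A semiring contains a \emph{copy} of $\mathbb{Q}^{+}$ if it has a subsemiring isomorphic to $\mathbb{Q}^{+}$. An \emph{ideal} of $S$ is a non-empty subset $I$ with $I+I\subseteq I$ and $SI\subseteq I$; $S$ is \emph{ideal-simple} if it has at least two elements and every ideal with at least two elements equals $S$. For a multiplicative abelian group $G$ and an element $o\notin G$, $U(G)=G\cup\{o\}$ is the semiring whose multiplication extends that of $G$ and in which $x+y=xo=ox=o$ for all $x,y\in U(G)$. Consider the following statements. - (A) Every finitely generated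 additively divisible semiring is additively idempotent. - (A1) Every finitely generated additively uniquely divisible semiring is additively idempotent. - (B) No finitely generated semiring contains a copy of $\mathbb{Q}^{+}$. - (B1) No finitely generated semiring with a unit contains a copy of $\mathbb{Q}^{+}$ sharing the unit. - (B2) Every finitely generated additively divisible semiring with a unit is additively idempotent. - (C) Every parasemifield that is finitely generated as a semiring is additively idempotent. - (C1) Every finitely generated infinite ideal-simple semiring is additively idempotent or isomorphic to $U(G)$ for some infinite finitely generated abelian group $G$. **Proposition 8.1.** $(\mathrm{A})\Leftrightarrow(\mathrm{A1})\Rightarrow(\mathrm{B})\Leftrightarrow(\mathrm{B1})\Leftrightarrow(\mathrm{B2})\Rightarrow(\mathrm{C})\Leftrightarrow(\mathrm{C1})$. -/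

import Mathlib

universe u

namespace DivSemiring

/-- A (commutative) semiring: a non-empty set with commutative, associative addition and
multiplication, multiplication distributing over addition. Neither an additive nor a multiplicative
neutral element is required. -/
class CSemiring (S : Type u) extends AddCommSemigroup S, CommSemigroup S, Distrib S where
  protected nonempty : Nonempty S

instance instNonempty (S : Type u) [CSemiring S] : Nonempty S := CSemiring.nonempty

section Notions

variable {S : Type u} [CSemiring S]

/-- The multiple `n a = a + ... + a` (`n` summands), for a positive integer `n`. -/
def pmul (n : ℕ+) (a : S) : S := PNat.recOn n a (fun _ b => b + a)

theorem pmul_one (a : S) : pmul 1 a = a := rfl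

theorem pmul_succ (n : ℕ+) (a : S) : pmul (n + 1) a = pmul n a + a := by
  simp [pmul]

/-- The subsemiring generated by a set `A`, as a predicate. -/
inductive Generated (A : Set S) : S → Prop
  | of {a : S} : a ∈ A → Generated A a
  | add {a b : S} : Generated A a → Generated A b → Generated A (a + b)
  | mul {a b : S} : Generated A a → Generated A b → Generated A (a * b)

/-- `e` is a unit element (multiplicatively neutral element) of `S`. -/
def IsOne (e : S) : Prop := ∀ x : S, e * x = x

/-- Ideals: non-empty subsets closed under addition and under multiplication by elements of `S`. -/
structure IsIdeal (I : Set S) : Prop where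
  nonempty : I.Nonempty
  add_mem : ∀ a ∈ I, ∀ b ∈ I, a + b ∈ I
  mul_mem : ∀ (s : S), ∀ a ∈ I, s * a ∈ I

variable (S)

/-- `S` is finitely generated as a semiring. -/
def FinGen : Prop := ∃ A : Set S, A.Finite ∧ ∀ x : S, Generated A x

def AddDivisible : Prop := ∀ (a : S) (n : ℕ+), ∃ b : S, a = pmul n b

def AddUniquelyDivisible : Prop := ∀ (a : S) (n : ℕ+), ∃! b : S, a = pmul n b

def AddIdempotent : Prop := ∀ a : S, a + a = a

/-- A parasemifield: the multiplicative semigroup is a non-trivial group. -/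
def IsParasemifield : Prop :=
  Nontrivial S ∧ ∃ e : S, IsOne e ∧ ∀ x : S, ∃ y : S, x * y = e

/-- `S` is non-trivial and every ideal with at least two elements is the whole of `S`. -/
def IdealSimple : Prop :=
  Nontrivial S ∧ ∀ I : Set S, IsIdeal I → I.Nontrivial → I = Set.univ

end Notions

/-- The parasemifield of positive rationals. -/
abbrev QPos : Type := {q : ℚ // 0 < q}

instance instQPos : CSemiring QPos where
  add_assoc := add_assoc
  add_comm := add_comm
  mul_assoc := mul_assoc
  mul_comm := mul_comm
  left_distrib := left_distrib
  right_distrib := right_distrib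
  nonempty := ⟨1⟩

/-- `f` is an embedding of semirings; its image is then a subsemiring isomorphic to the source. -/
structure IsEmbedding {R S : Type*} [CSemiring R] [CSemiring S] (f : R → S) : Prop where
  injective : Function.Injective f
  map_add : ∀ a b : R, f (a + b) = f a + f b
  map_mul : ∀ a b : R, f (a * b) = f a * f b

/-- The set `U(G) = G ∪ {o}` with a new element `o`. -/
inductive U (G : Type u) : Type u
  | o : U G
  | of : G → U G

/-- The semiring structure on `U(G)`: `x + y = o` for all `x, y`; the multiplication extends that of
`G`, and `x o = o x = o` for all `x`. -/
instance instU (G : Type u) [CommGroup G] : CSemiring (U G) where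
  add _ _ := U.o
  mul
    | U.of g, U.of h => U.of (g * h)
    | _, _ => U.o
  add_assoc _ _ _ := rfl
  add_comm _ _ := rfl
  mul_assoc := by
    rintro (_ | a) (_ | b) (_ | c) <;> first | rfl | exact congrArg U.of (mul_assoc a b c)
  mul_comm := by
    rintro (_ | a) (_ | b) <;> first | rfl | exact congrArg U.of (mul_comm a b)
  left_distrib := by rintro (_ | a) (_ | b) (_ | c) <;> rfl
  right_distrib := by rintro (_ | a) (_ | b) (_ | c) <;> rfl
  nonempty := ⟨U.o⟩

/-- (A) Every finitely generated additively divisible semiring is additively idempotent. -/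
def StatementA : Prop :=
  ∀ (S : Type u) [CSemiring S], FinGen S → AddDivisible S → AddIdempotent S

/-- (A1) Every finitely generated additively uniquely divisible semiring is additively
idempotent. -/
def StatementA1 : Prop :=
  ∀ (S : Type u) [CSemiring S], FinGen S → AddUniquelyDivisible S → AddIdempotent S

/-- (B) No finitely generated semiring contains a copy of the positive rationals. -/
def StatementB : Prop :=
  ∀ (S : Type u) [CSemiring S], FinGen S → ¬ ∃ f : QPos → S, IsEmbedding f

/-- (B1) No finitely generated semiring with a unit element contains a copy of the positive
rationals sharing the unit. -/
def StatementB1 : Prop :=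
  ∀ (S : Type u) [CSemiring S] (e : S), IsOne e → FinGen S →
    ¬ ∃ f : QPos → S, IsEmbedding f ∧ f 1 = e

/-- (B2) Every finitely generated additively divisible semiring with a unit is additively
idempotent. -/
def StatementB2 : Prop :=
  ∀ (S : Type u) [CSemiring S], FinGen S → AddDivisible S → (∃ e : S, IsOne e) → AddIdempotent S

/-- (C) Every parasemifield that is finitely generated as a semiring is additively idempotent. -/
def StatementC : Prop :=
  ∀ (S : Type u) [CSemiring S], IsParasemifield S → FinGen S → AddIdempotent S

/-- (C1) Every finitely generated infinite ideal-simple semiring is additively idempotent or a copy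
of `U(G)` for an infinite finitely generated abelian group `G`. -/
def StatementC1 : Prop :=
  ∀ (S : Type u) [CSemiring S], FinGen S → Infinite S → IdealSimple S →
    AddIdempotent S ∨
      ∃ (G : Type u) (_ : CommGroup G), Infinite G ∧ Group.FG G ∧ Nonempty (S ≃+* U G)

end DivSemiring

/-! Identify `a` and `b` when `n a = n b` for some `n ≥ 1`. On a divisible semiring this quotient is
uniquely divisible, and for finitely generated semirings idempotency comes back from it: every `a`
has an idempotent multiple `n a`, finite generation makes `n` uniform, and every element is `n`
times another. This gives (A1) ⇒ (A) and reduces (B1) ⇒ (B2) to uniquely divisible semirings with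
unit `e`. There the multiples of `e` are either distinct, and their fractions form a copy of ℚ⁺, or
they repeat, and some idempotent `k e` forces idempotency everywhere. Conversely, a copy of ℚ⁺
sharing the unit makes a semiring uniquely divisible and not idempotent; an arbitrary copy `f` is
brought to this situation inside `f 1 * S`, a homomorphic image of `S`.

(B2) ⇒ (C) holds since parasemifields are divisible, and (C1) ⇒ (C) since they are ideal-simple,
idempotent if finite, and never of the form U(G).

For (C) ⇒ (C1), an infinite ideal-simple semiring is a parasemifield or a group with a
multiplicatively absorbing `o`. If `o` is additively neutral, a negative of `e` would give a
finitely generated field, which is finite; so the nonzero elements form a parasemifield. If `o` is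
additively absorbing, either all sums are `o` and the semiring is U(G), or the elements `x` with `e
+ x ≠ o` form a parasemifield or a single point. The crux is that this set is finitely generated:
`mem_closure_of_generated` and `fg_closure_inf_subgroup`. -/

namespace DivSemiring

/-! ### Multiples and idempotent multiples. -/

section Multiples

variable {S : Type u} [CSemiring S]

theorem pmul_add_left (m n : ℕ+) (a : S) : pmul (m + n) a = pmul m a + pmul n a := by
  induction n with
  | one => rw [pmul_succ, pmul_one]
  | succ n ih => rw [← add_assoc, pmul_succ, ih, pmul_succ, add_assoc]

theorem pmul_add_right (n : ℕ+) (a b : S) : pmul n (a + b) = pmul n a + pmul n b := by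
  induction n with
  | one => simp only [pmul_one]
  | succ n ih => rw [pmul_succ, ih, pmul_succ, pmul_succ, add_add_add_comm]

theorem pmul_mul_left (m n : ℕ+) (a : S) : pmul (m * n) a = pmul m (pmul n a) := by
  induction m with
  | one => rw [one_mul, pmul_one]
  | succ m ih => rw [add_mul, one_mul, pmul_add_left, ih, pmul_succ]

theorem pmul_comm (m n : ℕ+) (a : S) : pmul m (pmul n a) = pmul n (pmul m a) := by
  rw [← pmul_mul_left, mul_comm, pmul_mul_left]

theorem pmul_mul (n : ℕ+) (a b : S) : pmul n a * b = pmul n (a * b) := by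
  induction n with
  | one => simp only [pmul_one]
  | succ n ih => rw [pmul_succ, add_mul, ih, pmul_succ]

theorem mul_pmul (n : ℕ+) (a b : S) : a * pmul n b = pmul n (a * b) := by
  rw [mul_comm, pmul_mul, mul_comm]

theorem map_pmul {R : Type*} [CSemiring R] {f : R → S} (hf : ∀ a b, f (a + b) = f a + f b)
    (n : ℕ+) (a : R) : f (pmul n a) = pmul n (f a) := by
  induction n with
  | one => rfl
  | succ n ih => rw [pmul_succ, hf, ih, pmul_succ]

/-- If two different multiples of `a` agree, then some multiple of `a` is additively idempotent. -/
theorem exists_pmul_idem_of_pmul_eq {a : S} {m n : ℕ+} (hmn : m ≠ n) (h : pmul m a = pmul n a) :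
    ∃ k : ℕ+, pmul k a + pmul k a = pmul k a := by
  wlog hlt : m < n generalizing m n
  · exact this hmn.symm h.symm (lt_of_le_of_ne (not_lt.mp hlt) hmn.symm)
  obtain ⟨d, rfl⟩ : ∃ d, n = m + d := ⟨n - m, (PNat.add_sub_of_lt hlt).symm⟩
  have step (j : ℕ+) : pmul (m + j * d) a = pmul m a := by
    induction j with
    | one => rw [one_mul, h]
    | succ j ih => rw [add_mul, one_mul, ← add_assoc, pmul_add_left, ih, ← pmul_add_left, h]
  -- From `m` on, the multiples of `a` have period `d`. Since `m * d` is at least `m` and divisible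
  -- by `d`, doubling it changes nothing.
  refine ⟨m * d, ?_⟩
  rw [← pmul_add_left]
  rcases (one_le : 1 ≤ d).eq_or_lt with rfl | hd
  · rw [mul_one]
    have := step m
    rwa [mul_one] at this
  · have hlt : m < m * d := by
      have := Nat.mul_lt_mul_of_pos_left (PNat.coe_lt_coe _ _ |>.mpr hd) m.pos
      rw [← PNat.coe_lt_coe, PNat.mul_coe]
      simpa using this
    obtain ⟨r, hr⟩ : ∃ r, m * d = m + r := ⟨m * d - m, (PNat.add_sub_of_lt hlt).symm⟩
    calc pmul (m * d + m * d) a = pmul (m + m * d + r) a := by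
          congr 1
          nth_rewrite 1 [hr]
          rw [add_right_comm]
      _ = pmul (m * d) a := by rw [pmul_add_left, step, ← pmul_add_left, ← hr]

theorem AddDivisible.exists_pmul_eq (h : AddDivisible S) (n : ℕ+) (a : S) :
    ∃ b : S, pmul n b = a :=
  let ⟨b, hb⟩ := h a n
  ⟨b, hb.symm⟩

theorem addDivisible_of_unique (h : AddUniquelyDivisible S) : AddDivisible S :=
  fun a n => (h a n).exists

theorem AddUniquelyDivisible.pmul_injective (h : AddUniquelyDivisible S) {n : ℕ+} {a b : S}
    (hab : pmul n a = pmul n b) : a = b :=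
  (h (pmul n a) n).unique rfl hab

/-- In an additively divisible semiring with unit, idempotency of a multiple of the unit suffices. -/
theorem addIdempotent_of_pmul_one_idem (h : AddDivisible S) {e : S} (he : IsOne e) {k : ℕ+}
    (hk : pmul k e + pmul k e = pmul k e) : AddIdempotent S := by
  intro a
  obtain ⟨b, rfl⟩ := h.exists_pmul_eq k a
  rw [← he b, ← pmul_mul, ← add_mul, hk]

theorem Generated.image {R : Type*} [CSemiring R] {f : R → S}
    (hadd : ∀ a b, f (a + b) = f a + f b) (hmul : ∀ a b, f (a * b) = f a * f b)
    {A : Set R} {x : R} (hx : Generated A x) : Generated (f '' A) (f x) := by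
  induction hx with
  | of ha => exact .of ⟨_, ha, rfl⟩
  | add _ _ iha ihb => rw [hadd]; exact .add iha ihb
  | mul _ _ iha ihb => rw [hmul]; exact .mul iha ihb

theorem FinGen.of_surjective {R : Type*} [CSemiring R] {f : R → S}
    (hadd : ∀ a b, f (a + b) = f a + f b) (hmul : ∀ a b, f (a * b) = f a * f b)
    (hf : Function.Surjective f) (h : FinGen R) : FinGen S := by
  obtain ⟨A, hA, hgen⟩ := h
  refine ⟨f '' A, hA.image f, fun x => ?_⟩
  obtain ⟨y, rfl⟩ := hf x
  exact (hgen y).image hadd hmul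

/-- If every element of a finite generating set has an additively idempotent multiple, then so does,
with a uniform multiplier, every element. -/
theorem FinGen.exists_pmul_idem (h : FinGen S)
    (hid : ∀ a : S, ∃ n : ℕ+, pmul n a + pmul n a = pmul n a) :
    ∃ n : ℕ+, ∀ a : S, pmul n a + pmul n a = pmul n a := by
  obtain ⟨A, hA, hgen⟩ := h
  choose n hn using hid
  -- Idempotency of `n a` passes to its multiples, so the product works for all generators at once.
  refine ⟨∏ a ∈ hA.toFinset, n a, fun x => ?_⟩
  induction hgen x with
  | @of a ha =>
    obtain ⟨c, hc⟩ := Finset.dvd_prod_of_mem n (hA.mem_toFinset.mpr ha)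
    rw [hc, mul_comm, pmul_mul_left, ← pmul_add_right, hn]
  | add _ _ iha ihb => rw [pmul_add_right, add_add_add_comm, iha, ihb]
  | mul _ _ iha _ => rw [← pmul_mul, ← add_mul, iha]

theorem addIdempotent_of_pmul_idem (hS : FinGen S) (hd : AddDivisible S)
    (hid : ∀ a : S, ∃ n : ℕ+, pmul n a + pmul n a = pmul n a) : AddIdempotent S := by
  obtain ⟨n, hn⟩ := hS.exists_pmul_idem hid
  intro a
  obtain ⟨b, rfl⟩ := hd.exists_pmul_eq n a
  exact hn b

end Multiples

/-! ### The additively torsion-free quotient. -/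

section TorsionQuotient

variable (S : Type u) [CSemiring S]

/-- The congruence identifying elements that have a common multiple `n a = n b`. -/
def torsionSetoid : Setoid S where
  r a b := ∃ n : ℕ+, pmul n a = pmul n b
  iseqv :=
    { refl := fun _ => ⟨1, rfl⟩
      symm := fun ⟨n, h⟩ => ⟨n, h.symm⟩
      trans := by
        rintro a b c ⟨m, h⟩ ⟨n, h'⟩
        refine ⟨n * m, ?_⟩
        rw [pmul_mul_left, h, pmul_comm, h', ← pmul_mul_left, mul_comm] }

/-- The largest additively torsion-free quotient. -/
abbrev TorsionFreeQuotient : Type u := Quotient (torsionSetoid S)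

instance : Add (TorsionFreeQuotient S) where
  add := Quotient.map₂ (· + ·) <| by
    rintro a b ⟨m, h⟩ c d ⟨n, h'⟩
    refine ⟨m * n, ?_⟩
    rw [pmul_add_right, pmul_add_right, pmul_mul_left m n c, h', ← pmul_mul_left, mul_comm m n,
      pmul_mul_left n m a, h, ← pmul_mul_left]

instance : Mul (TorsionFreeQuotient S) where
  mul := Quotient.map₂ (· * ·) <| by
    rintro a b ⟨m, h⟩ c d ⟨n, h'⟩
    refine ⟨m * n, ?_⟩
    rw [pmul_mul_left, ← mul_pmul, h', ← pmul_mul, h, pmul_mul, mul_pmul, pmul_mul_left]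

instance : CSemiring (TorsionFreeQuotient S) where
  add_assoc := by
    rintro ⟨a⟩ ⟨b⟩ ⟨c⟩
    exact congrArg (Quotient.mk _) (add_assoc a b c)
  add_comm := by
    rintro ⟨a⟩ ⟨b⟩
    exact congrArg (Quotient.mk _) (add_comm a b)
  mul_assoc := by
    rintro ⟨a⟩ ⟨b⟩ ⟨c⟩
    exact congrArg (Quotient.mk _) (mul_assoc a b c)
  mul_comm := by
    rintro ⟨a⟩ ⟨b⟩
    exact congrArg (Quotient.mk _) (mul_comm a b)
  left_distrib := by
    rintro ⟨a⟩ ⟨b⟩ ⟨c⟩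
    exact congrArg (Quotient.mk _) (mul_add a b c)
  right_distrib := by
    rintro ⟨a⟩ ⟨b⟩ ⟨c⟩
    exact congrArg (Quotient.mk _) (add_mul a b c)
  nonempty := ⟨Quotient.mk _ (Classical.arbitrary S)⟩

variable {S}

/-- The canonical projection. -/
def toTorsionFree (a : S) : TorsionFreeQuotient S := Quotient.mk _ a

theorem toTorsionFree_add (a b : S) :
    toTorsionFree (a + b) = toTorsionFree a + toTorsionFree b := rfl

theorem toTorsionFree_mul (a b : S) :
    toTorsionFree (a * b) = toTorsionFree a * toTorsionFree b := rfl

theorem toTorsionFree_surjective : Function.Surjective (toTorsionFree (S := S)) :=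
  Quotient.mk_surjective

theorem toTorsionFree_eq_iff {a b : S} :
    toTorsionFree a = toTorsionFree b ↔ ∃ n : ℕ+, pmul n a = pmul n b :=
  Quotient.eq (r := torsionSetoid S)

theorem toTorsionFree_pmul (n : ℕ+) (a : S) :
    toTorsionFree (pmul n a) = pmul n (toTorsionFree a) :=
  map_pmul toTorsionFree_add n a

theorem FinGen.torsionFreeQuotient (h : FinGen S) : FinGen (TorsionFreeQuotient S) :=
  h.of_surjective toTorsionFree_add toTorsionFree_mul toTorsionFree_surjective

/-- For uniqueness: if `n b` and `n c` agree after multiplication by `k`, then `b` and `c` agree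
after multiplication by `k n`. -/
theorem AddDivisible.torsionFreeQuotient (h : AddDivisible S) :
    AddUniquelyDivisible (TorsionFreeQuotient S) := by
  intro a n
  obtain ⟨a, rfl⟩ := toTorsionFree_surjective a
  obtain ⟨b, rfl⟩ := h.exists_pmul_eq n a
  refine ⟨toTorsionFree b, toTorsionFree_pmul n b, fun c hc => ?_⟩
  obtain ⟨c, rfl⟩ := toTorsionFree_surjective c
  rw [← toTorsionFree_pmul, toTorsionFree_eq_iff] at hc
  obtain ⟨k, hk⟩ := hc
  exact toTorsionFree_eq_iff.mpr ⟨k * n, by rw [pmul_mul_left, ← hk, pmul_mul_left]⟩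

theorem addIdempotent_of_torsionFreeQuotient (hS : FinGen S) (hd : AddDivisible S)
    (hid : AddIdempotent (TorsionFreeQuotient S)) : AddIdempotent S := by
  refine addIdempotent_of_pmul_idem hS hd fun a => ?_
  obtain ⟨n, hn⟩ := toTorsionFree_eq_iff.mp
    ((toTorsionFree_add a a).trans (hid (toTorsionFree a)))
  exact ⟨n, by rw [← pmul_add_right, hn]⟩

end TorsionQuotient

/-! ### Rational multiples of the unit. -/

section RationalMultiples

variable {S : Type u} [CSemiring S]

/-- In an additively uniquely divisible semiring with unit, either the positive rational multiples
of the unit form a copy of the positive rationals, or two multiples of the unit agree. -/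
theorem AddUniquelyDivisible.exists_embedding_or (h : AddUniquelyDivisible S) {e : S}
    (he : IsOne e) :
    (∃ f : QPos → S, IsEmbedding f ∧ f 1 = e) ∨ ∃ m n : ℕ+, m ≠ n ∧ pmul m e = pmul n e := by
  refine or_iff_not_imp_right.mpr fun hne => ?_
  have hinj {m n : ℕ+} (hmn : pmul m e = pmul n e) : m = n :=
    by_contra fun h' => hne ⟨m, n, h', hmn⟩
  let num (q : QPos) : ℕ+ := ⟨q.1.num.toNat, by have := Rat.num_pos.mpr q.2; omega⟩
  let den (q : QPos) : ℕ+ := ⟨q.1.den, q.1.den_pos⟩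
  have hq (q : QPos) : q.1 * (den q : ℕ) = (num q : ℕ) := by
    have h1 : ((q.1.num.toNat : ℤ) : ℚ) = (q.1.num : ℚ) := by
      rw [Int.toNat_of_nonneg (Rat.num_pos.mpr q.2).le]
    have h2 := Rat.mul_den_eq_num q.1
    rw [← h1] at h2
    exact_mod_cast h2
  choose f hf using fun q : QPos => (addDivisible_of_unique h).exists_pmul_eq (den q) (pmul (num q) e)
  -- The value `f q` may be computed from any fraction `m / n` equal to `q`, so sums and products
  -- need no reduction to lowest terms.
  have key {q : QPos} {m n : ℕ+} {b : S} (hqmn : q.1 * (n : ℕ) = (m : ℕ))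
      (hb : pmul n b = pmul m e) : f q = b := by
    apply h.pmul_injective (n := n * den q)
    have : n * num q = den q * m := by
      have h1 := hq q
      have : ((n : ℕ) : ℚ) * (num q : ℕ) = (den q : ℕ) * (m : ℕ) := by
        rw [← h1, ← hqmn]; ring
      exact PNat.eq (by exact_mod_cast this)
    rw [pmul_mul_left, hf, ← pmul_mul_left, this, pmul_mul_left, ← hb, ← pmul_mul_left, mul_comm]
  refine ⟨f, ⟨fun p q hpq => ?_, fun p q => key (m := num p * den q + num q * den p)
    (n := den p * den q) ?_ ?_, fun p q => key (m := num p * num q) (n := den p * den q) ?_ ?_⟩,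
    key (m := 1) (n := 1) ?_ rfl⟩
  · have h1 : pmul (den q * num p) e = pmul (den p * num q) e := by
      rw [pmul_mul_left, ← hf p, hpq, pmul_comm, hf q, ← pmul_mul_left]
    have h2 : ((den q : ℕ) : ℚ) * (num p : ℕ) = (den p : ℕ) * (num q : ℕ) := by
      exact_mod_cast congrArg PNat.val (hinj h1)
    rw [← hq, ← hq] at h2
    have hp0 : ((den p : ℕ) : ℚ) ≠ 0 := by exact_mod_cast (den p).ne_zero
    have hq0 : ((den q : ℕ) : ℚ) ≠ 0 := by exact_mod_cast (den q).ne_zero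
    refine Subtype.ext (mul_right_cancel₀ (mul_ne_zero hp0 hq0) ?_)
    linear_combination h2
  · change (p.1 + q.1) * _ = _
    push_cast
    rw [← hq, ← hq]
    ring
  · rw [pmul_add_right, pmul_add_left]
    congr 1
    · rw [mul_comm (den p), pmul_mul_left, hf, ← pmul_mul_left, mul_comm]
    · rw [pmul_mul_left, hf, ← pmul_mul_left, mul_comm]
  · change (p.1 * q.1) * _ = _
    push_cast
    rw [← hq, ← hq]
    ring
  · rw [pmul_mul_left, ← mul_pmul, hf, ← pmul_mul, hf, pmul_mul, he, pmul_mul_left]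
  · change (1 : ℚ) * _ = _
    simp

end RationalMultiples


/-! ### Subsemirings that are groups. -/

section Subsemirings

variable {S : Type u} [CSemiring S]

/-- The semiring structure on a non-empty subset closed under addition and multiplication. -/
abbrev subCSemiring (p : Set S) (hne : p.Nonempty) (hadd : ∀ a ∈ p, ∀ b ∈ p, a + b ∈ p)
    (hmul : ∀ a ∈ p, ∀ b ∈ p, a * b ∈ p) : CSemiring p where
  add a b := ⟨a.1 + b.1, hadd _ a.2 _ b.2⟩
  mul a b := ⟨a.1 * b.1, hmul _ a.2 _ b.2⟩
  add_assoc a b c := Subtype.ext (add_assoc a.1 b.1 c.1)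
  add_comm a b := Subtype.ext (add_comm a.1 b.1)
  mul_assoc a b c := Subtype.ext (mul_assoc a.1 b.1 c.1)
  mul_comm a b := Subtype.ext (mul_comm a.1 b.1)
  left_distrib a b c := Subtype.ext (mul_add a.1 b.1 c.1)
  right_distrib a b c := Subtype.ext (add_mul a.1 b.1 c.1)
  nonempty := hne.to_subtype

theorem finGen_subCSemiring {p : Set S} (hne : p.Nonempty) (hadd : ∀ a ∈ p, ∀ b ∈ p, a + b ∈ p)
    (hmul : ∀ a ∈ p, ∀ b ∈ p, a * b ∈ p) {B : Set S} (hB : B.Finite) (hBp : B ⊆ p)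
    (hgen : ∀ x ∈ p, Generated B x) : @FinGen p (subCSemiring p hne hadd hmul) := by
  let := subCSemiring p hne hadd hmul
  refine ⟨Subtype.val ⁻¹' B, hB.preimage Subtype.val_injective.injOn, ?_⟩
  have key : ∀ x, Generated B x → ∃ hx : x ∈ p, Generated (Subtype.val ⁻¹' B : Set p) ⟨x, hx⟩ := by
    intro x hx
    induction hx with
    | of ha => exact ⟨hBp ha, .of ha⟩
    | add _ _ iha ihb =>
      obtain ⟨ha, ga⟩ := iha
      obtain ⟨hb, gb⟩ := ihb
      exact ⟨hadd _ ha _ hb, .add ga gb⟩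
    | mul _ _ iha ihb =>
      obtain ⟨ha, ga⟩ := iha
      obtain ⟨hb, gb⟩ := ihb
      exact ⟨hmul _ ha _ hb, .mul ga gb⟩
  exact fun x => (key x.1 (hgen x.1 x.2)).2

/-- Under (C), a finitely generated subsemiring that is a multiplicative group has an additively
idempotent unit. -/
theorem StatementC.one_add_one (hC : StatementC.{u}) {p : Set S} {e : S} (hep : e ∈ p)
    (hadd : ∀ a ∈ p, ∀ b ∈ p, a + b ∈ p) (hmul : ∀ a ∈ p, ∀ b ∈ p, a * b ∈ p)
    (he : ∀ a ∈ p, e * a = a) (hinv : ∀ a ∈ p, ∃ b ∈ p, a * b = e) {B : Set S} (hB : B.Finite)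
    (hBp : B ⊆ p) (hgen : ∀ x ∈ p, Generated B x) : e + e = e := by
  rcases p.subsingleton_or_nontrivial with hp | hp
  · exact hp (hadd e hep e hep) hep
  · let := subCSemiring p ⟨e, hep⟩ hadd hmul
    have hpara : IsParasemifield p := by
      refine ⟨hp.coe_sort, ⟨e, hep⟩, fun a => Subtype.ext (he a.1 a.2), fun a => ?_⟩
      obtain ⟨b, hb, hab⟩ := hinv a.1 a.2
      exact ⟨⟨b, hb⟩, Subtype.ext hab⟩
    exact congrArg Subtype.val
      (hC p hpara (finGen_subCSemiring ⟨e, hep⟩ hadd hmul hB hBp hgen) ⟨e, hep⟩)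

end Subsemirings

/-! ### Copies of the positive rationals. -/

section CopiesOfRationals

theorem pmul_qpos (n : ℕ+) (q : QPos) : (pmul n q).1 = (n : ℕ) * q.1 := by
  induction n with
  | one => simp [pmul_one]
  | succ n ih =>
    rw [pmul_succ]
    change (pmul n q).1 + q.1 = _
    rw [ih]
    push_cast
    ring

theorem qpos_div (n : ℕ+) (q : QPos) : ∃ r : QPos, pmul n r = q :=
  have hn : (0 : ℚ) < (n : ℕ) := by exact_mod_cast n.pos
  ⟨⟨q.1 / (n : ℕ), div_pos q.2 hn⟩, Subtype.ext (by rw [pmul_qpos, mul_div_cancel₀ _ hn.ne'])⟩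

theorem qpos_one_add_one_ne : (1 : QPos) + 1 ≠ 1 := fun h => by
  have : (1 : ℚ) + 1 = 1 := congrArg Subtype.val h
  norm_num at this

variable {S : Type u} [CSemiring S]

/-- A semiring with unit containing a copy of the positive rationals sharing the unit is additively
uniquely divisible. -/
theorem IsEmbedding.addUniquelyDivisible {f : QPos → S} (hf : IsEmbedding f)
    (he : IsOne (f 1)) : AddUniquelyDivisible S := by
  intro a n
  obtain ⟨r, hr⟩ := qpos_div n 1
  have hr' : pmul n (f r) = f 1 := by rw [← map_pmul hf.map_add, hr]
  refine ⟨f r * a, by change a = pmul n (f r * a); rw [← pmul_mul, hr', he], fun b hb => ?_⟩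
  rw [hb, mul_pmul, ← pmul_mul, hr', he]

theorem IsEmbedding.not_addIdempotent {f : QPos → S} (hf : IsEmbedding f) :
    ¬ AddIdempotent S := fun h =>
  qpos_one_add_one_ne (hf.injective ((hf.map_add 1 1).trans (h _)))

/-- A finitely generated semiring containing a copy of the positive rationals has a finitely
generated subsemiring with a unit containing a copy sharing the unit. -/
theorem IsEmbedding.exists_shared_unit (hS : FinGen S) {f : QPos → S} (hf : IsEmbedding f) :
    ∃ (T : Type u) (_ : CSemiring T) (g : QPos → T),
      FinGen T ∧ IsEmbedding g ∧ IsOne (g 1) := by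
  have hone (q : QPos) : f 1 * f q = f q := by
    rw [← hf.map_mul]
    exact congrArg f (Subtype.ext (one_mul q.1))
  -- As `f 1` is a multiplicative idempotent, `x ↦ f 1 * x` is a retraction homomorphism of `S` onto
  -- `p`; finite generation is inherited through it.
  let p : Set S := {x | f 1 * x = x}
  let : CSemiring p := subCSemiring p ⟨f 1, hone 1⟩
    (fun a ha b hb => by
      change f 1 * (a + b) = a + b
      rw [mul_add, show f 1 * a = a from ha, show f 1 * b = b from hb])
    (fun a ha b _ => by
      change f 1 * (a * b) = a * b
      rw [← mul_assoc, show f 1 * a = a from ha])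
  refine ⟨p, inferInstance, fun q => ⟨f q, hone q⟩, ?_, ⟨?_, ?_, ?_⟩, fun x => Subtype.ext x.2⟩
  · refine hS.of_surjective (f := fun x => (⟨f 1 * x, ?_⟩ : p)) ?_ ?_ ?_
    · change f 1 * (f 1 * x) = f 1 * x
      rw [← mul_assoc, hone]
    · exact fun a b => Subtype.ext (mul_add _ a b)
    · refine fun a b => Subtype.ext ?_
      change f 1 * (a * b) = f 1 * a * (f 1 * b)
      rw [mul_mul_mul_comm, hone]
    · exact fun x => ⟨x.1, Subtype.ext x.2⟩
  · exact fun a b hab => hf.injective (congrArg Subtype.val hab)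
  · exact fun a b => Subtype.ext (hf.map_add a b)
  · exact fun a b => Subtype.ext (hf.map_mul a b)

end CopiesOfRationals

/-! ### Implications among (A), (A1), (B), (B1), (B2). -/

theorem statementA_iff_statementA1 : StatementA.{u} ↔ StatementA1.{u} :=
  ⟨fun h S _ hS hd => h S hS (addDivisible_of_unique hd), fun h S _ hS hd =>
    addIdempotent_of_torsionFreeQuotient hS hd
      (h (TorsionFreeQuotient S) hS.torsionFreeQuotient hd.torsionFreeQuotient)⟩

theorem StatementA1.statementB (h : StatementA1.{u}) : StatementB.{u} := by
  rintro S _ hS ⟨f, hf⟩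
  obtain ⟨T, _, g, hT, hg, hg1⟩ := hf.exists_shared_unit hS
  exact hg.not_addIdempotent (h T hT (hg.addUniquelyDivisible hg1))

theorem statementB_iff_statementB1 : StatementB.{u} ↔ StatementB1.{u} := by
  refine ⟨fun h S _ e _ hS ⟨f, hf, _⟩ => h S hS ⟨f, hf⟩, ?_⟩
  rintro h S _ hS ⟨f, hf⟩
  obtain ⟨T, _, g, hT, hg, hg1⟩ := hf.exists_shared_unit hS
  exact h T (g 1) hg1 hT ⟨g, hg, rfl⟩

theorem statementB1_iff_statementB2 : StatementB1.{u} ↔ StatementB2.{u} := by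
  refine ⟨?_, ?_⟩
  · rintro h S _ hS hd ⟨e, he⟩
    refine addIdempotent_of_torsionFreeQuotient hS hd ?_
    have hd' := hd.torsionFreeQuotient
    have he' : IsOne (toTorsionFree e) := fun x => by
      obtain ⟨x, rfl⟩ := toTorsionFree_surjective x
      rw [← toTorsionFree_mul, he]
    rcases hd'.exists_embedding_or he' with hf | ⟨m, n, hmn, hmn'⟩
    · exact (h _ _ he' hS.torsionFreeQuotient hf).elim
    · obtain ⟨k, hk⟩ := exists_pmul_idem_of_pmul_eq hmn hmn'
      exact addIdempotent_of_pmul_one_idem (addDivisible_of_unique hd') he' hk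
  · rintro h S _ e he hS ⟨f, hf, rfl⟩
    exact hf.not_addIdempotent
      (h S hS (addDivisible_of_unique (hf.addUniquelyDivisible he)) ⟨_, he⟩)

/-! ### Parasemifields. -/

section Parasemifields

variable {S : Type u} [CSemiring S]

/-- The inverse of `n e` serves as `e / n`. -/
theorem IsParasemifield.addDivisible (h : IsParasemifield S) : AddDivisible S := by
  obtain ⟨-, e, he, hinv⟩ := h
  intro a n
  obtain ⟨y, hy⟩ := hinv (pmul n e)
  refine ⟨y * a, ?_⟩
  have : pmul n y = e := by rw [← hy, pmul_mul, he]
  rw [← pmul_mul, this, he]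

theorem exists_ne_pmul_eq [Finite S] (a : S) : ∃ m n : ℕ+, m ≠ n ∧ pmul m a = pmul n a :=
  Finite.exists_ne_map_eq_of_infinite fun n : ℕ+ => pmul n a

theorem IsParasemifield.addIdempotent_of_finite [Finite S] (h : IsParasemifield S) :
    AddIdempotent S := by
  obtain ⟨-, e, he, -⟩ := id h
  obtain ⟨m, n, hmn, hmn'⟩ := exists_ne_pmul_eq e
  obtain ⟨k, hk⟩ := exists_pmul_idem_of_pmul_eq hmn hmn'
  exact addIdempotent_of_pmul_one_idem h.addDivisible he hk

theorem IsParasemifield.idealSimple (h : IsParasemifield S) : IdealSimple S := by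
  obtain ⟨hnt, e, he, hinv⟩ := h
  refine ⟨hnt, fun I hI _ => Set.eq_univ_of_forall fun x => ?_⟩
  obtain ⟨a, ha⟩ := hI.nonempty
  obtain ⟨y, hy⟩ := hinv a
  have := hI.mul_mem (x * y) a ha
  rwa [mul_assoc, mul_comm y, hy, mul_comm, he] at this

/-- A group with a multiplicatively absorbing element is trivial. -/
theorem IsParasemifield.not_mulEquiv_U (h : IsParasemifield S) (G : Type u) [CommGroup G] :
    IsEmpty (S ≃+* U G) := by
  refine ⟨fun φ => ?_⟩
  obtain ⟨hnt, e, he, hinv⟩ := h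
  obtain ⟨z, hz⟩ := φ.surjective U.o
  have habs (x : S) : z * x = z := φ.injective (by rw [map_mul, hz]; rfl)
  have hze : z = e := by
    obtain ⟨y, hy⟩ := hinv z
    rw [← hy, habs]
  obtain ⟨a, b, hab⟩ := hnt
  exact hab (by rw [← he a, ← he b, ← hze, habs, habs])

end Parasemifields

theorem StatementB2.statementC (h : StatementB2.{u}) : StatementC.{u} := fun S _ hp hS =>
  h S hS hp.addDivisible ⟨hp.2.choose, hp.2.choose_spec.1⟩

theorem StatementC1.statementC (h : StatementC1.{u}) : StatementC.{u} := by
  intro S _ hp hS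
  rcases finite_or_infinite S with _ | hinf
  · exact hp.addIdempotent_of_finite
  · rcases h S hS hinf hp.idealSimple with hid | ⟨G, _, -, -, ⟨φ⟩⟩
    · exact hid
    · exact ((hp.not_mulEquiv_U G).false φ).elim


/-! ### Ideal-simple semirings with constant product. -/

section ConstantProduct

variable {S : Type u} [CSemiring S]

/-- If `m a = n a` with `m < n`, then for `k > n` the multiple `k a` equals `(m + (k - n)) a`, so
only multipliers below `n` matter. -/
theorem finite_range_pmul {a : S} {m n : ℕ+} (hmn : m ≠ n) (h : pmul m a = pmul n a) :
    (Set.range fun k : ℕ+ => pmul k a).Finite := by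
  wlog hlt : m < n generalizing m n
  · exact this hmn.symm h.symm (lt_of_le_of_ne (not_lt.mp hlt) hmn.symm)
  refine ((Set.finite_Iio n).image fun k => pmul k a).subset ?_
  rintro _ ⟨k, rfl⟩
  induction k using PNat.strongInductionOn with
  | _ k ih =>
    rcases lt_or_ge k n with hk | hk
    · exact ⟨k, hk, rfl⟩
    rcases hk.eq_or_lt with rfl | hk
    · exact ⟨m, hlt, h⟩
    · obtain ⟨r, rfl⟩ : ∃ r, k = n + r := ⟨k - n, (PNat.add_sub_of_lt hk).symm⟩
      have heq : pmul (m + r) a = pmul (n + r) a := by rw [pmul_add_left, h, ← pmul_add_left]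
      obtain ⟨j, hj, hj'⟩ := ih (m + r) (add_lt_add_left hlt r)
      exact ⟨j, hj, hj'.trans heq⟩

/-- An ideal-simple semiring with constant multiplication is finite. -/
theorem IdealSimple.finite_of_mul_const (h : IdealSimple S) {c : S} (hc : ∀ x y : S, x * y = c) :
    Finite S := by
  obtain ⟨hnt, hI⟩ := h
  have hcc : c + c = c := by
    have := mul_add c c c
    rwa [hc, hc, eq_comm] at this
  have hspan (b : S) (hb : b ≠ c) :
      {x : S | x = c ∨ ∃ n : ℕ+, x = pmul n b ∨ x = pmul n b + c} = Set.univ := by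
    refine hI _ ⟨⟨c, Or.inl rfl⟩, ?_, fun s a _ => Or.inl (hc s a)⟩
      ⟨c, Or.inl rfl, b, Or.inr ⟨1, Or.inl rfl⟩, hb.symm⟩
    rintro x (rfl | ⟨m, rfl | rfl⟩) y (rfl | ⟨n, rfl | rfl⟩)
    · exact Or.inl hcc
    · exact Or.inr ⟨n, Or.inr (add_comm _ _)⟩
    · exact Or.inr ⟨n, Or.inr (by rw [add_left_comm, hcc])⟩
    · exact Or.inr ⟨m, Or.inr rfl⟩
    · exact Or.inr ⟨m + n, Or.inl (pmul_add_left m n b).symm⟩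
    · exact Or.inr ⟨m + n, Or.inr (by rw [pmul_add_left, add_assoc])⟩
    · exact Or.inr ⟨m, Or.inr (by rw [add_assoc, hcc])⟩
    · exact Or.inr ⟨m + n, Or.inr (by rw [pmul_add_left, add_right_comm])⟩
    · exact Or.inr ⟨m + n, Or.inr (by rw [pmul_add_left, add_add_add_comm, hcc])⟩
  obtain ⟨a, ha⟩ := exists_ne c
  -- If `2a = c`, then `2a = 4a`. Otherwise the ideal spanned by `2a` is everything, so `a` is `n
  -- (2a)` or `n (2a) + c`, and in the latter case adding `c` fixes every multiple of `a`. In all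
  -- cases two multiples of `a` agree.
  have hfin : (Set.range fun k : ℕ+ => pmul k a).Finite := by
    have h2 : pmul 2 a = a + a := pmul_succ 1 a
    by_cases hb : a + a = c
    · refine finite_range_pmul (m := 2) (n := 2 + 2) (by decide) ?_
      rw [pmul_add_left, h2, hb, hcc]
    · have hmem := Set.eq_univ_iff_forall.mp (hspan _ hb) a
      have hne (n : ℕ+) : (1 : ℕ+) ≠ n * 2 := fun h => by
        have := congrArg PNat.val h
        rw [PNat.mul_coe] at this
        change 1 = (n : ℕ) * 2 at this
        omega
      rcases hmem with hac | ⟨n, hn | hn⟩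
      · exact absurd hac ha
      · exact finite_range_pmul (hne n) (by rw [pmul_mul_left, h2, ← hn, pmul_one])
      · rw [← h2, ← pmul_mul_left] at hn
        have hac : a + c = a := by rw [hn, add_assoc, hcc]
        have habs (k : ℕ+) : pmul k a + c = pmul k a := by
          induction k with
          | one => exact hac
          | succ k _ => rw [pmul_succ, add_assoc, hac]
        exact finite_range_pmul (hne n) (by rw [pmul_one, ← habs (n * 2), ← hn])
  rw [← Set.finite_univ_iff, ← hspan a ha]
  refine (((hfin.image (· + c)).union hfin).insert c).subset ?_
  rintro x (rfl | ⟨n, rfl | rfl⟩)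
  · exact Set.mem_insert _ _
  · exact Or.inr (Or.inr ⟨n, rfl⟩)
  · exact Or.inr (Or.inl ⟨_, ⟨n, rfl⟩, rfl⟩)

end ConstantProduct

/-! ### Structure of infinite ideal-simple semirings. -/

section Structure

variable {S : Type u} [CSemiring S]

theorem isIdeal_multiples (a : S) : IsIdeal {x : S | ∃ s, s * a = x} := by
  refine ⟨⟨a * a, a, rfl⟩, ?_, ?_⟩
  · rintro _ ⟨s, rfl⟩ _ ⟨t, rfl⟩
    exact ⟨s + t, add_mul s t a⟩
  · rintro r _ ⟨s, rfl⟩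
    exact ⟨r * s, mul_assoc r s a⟩

/-- A subset closed under solving `s a = b` has a unit and inverses. -/
theorem exists_one_of_forall_exists_mul {p : Set S} (hne : p.Nonempty)
    (h : ∀ a ∈ p, ∀ b ∈ p, ∃ s ∈ p, s * a = b) :
    ∃ e ∈ p, (∀ a ∈ p, e * a = a) ∧ ∀ a ∈ p, ∃ b ∈ p, a * b = e := by
  obtain ⟨a, ha⟩ := hne
  obtain ⟨e, he, hea⟩ := h a ha a ha
  refine ⟨e, he, fun b hb => ?_, fun b hb => ?_⟩
  · obtain ⟨s, -, rfl⟩ := h a ha b hb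
    rw [mul_left_comm, hea]
  · obtain ⟨s, hs, hsb⟩ := h b hb e he
    exact ⟨s, hs, by rw [mul_comm, hsb]⟩

/-- The nonzero elements of `S` form a multiplicative group with unit `e`, and `o` is
multiplicatively absorbing. -/
structure IsGroupWithAbsorbing (o e : S) : Prop where
  one_ne : e ≠ o
  absorb_mul : ∀ x, o * x = o
  one_mul : ∀ x, e * x = x
  exists_inv : ∀ x, x ≠ o → ∃ y, y ≠ o ∧ x * y = e

/-- An infinite ideal-simple semiring is a parasemifield, or a multiplicative group with an
absorbing element. -/
theorem IdealSimple.isParasemifield_or [Infinite S] (h : IdealSimple S) :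
    IsParasemifield S ∨ ∃ o e : S, IsGroupWithAbsorbing o e := by
  have hdich (a : S) : (∃ c, ∀ s, s * a = c) ∨ ∀ b, ∃ s, s * a = b := by
    rcases ({x : S | ∃ s, s * a = x} : Set S).subsingleton_or_nontrivial with hs | hs
    · exact Or.inl ⟨a * a, fun s => hs ⟨s, rfl⟩ ⟨a, rfl⟩⟩
    · exact Or.inr (Set.eq_univ_iff_forall.mp (h.2 _ (isIdeal_multiples a) hs))
  -- `Z` is empty or an ideal. Empty gives a group, a single point is the absorbing element, and `Z
  -- = S` makes the product constant, hence `S` finite.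
  let Z : Set S := {a | ∃ c, ∀ s, s * a = c}
  rcases Z.eq_empty_or_nonempty with hZ | hZ
  · left
    have hsolve (a b : S) : ∃ s, s * a = b :=
      (hdich a).resolve_left (fun ha => (hZ ▸ ha : a ∈ (∅ : Set S))) b
    obtain ⟨e, -, he, hinv⟩ := exists_one_of_forall_exists_mul (p := Set.univ) (S := S)
      Set.univ_nonempty fun a _ b _ => (hsolve a b).imp fun s hs => ⟨trivial, hs⟩
    exact ⟨h.1, e, fun x => he x trivial, fun x => (hinv x trivial).imp fun _ hy => hy.2⟩
  · have hZI : IsIdeal Z := by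
      refine ⟨hZ, ?_, ?_⟩
      · rintro a ⟨c, hc⟩ b ⟨d, hd⟩
        exact ⟨c + d, fun s => by rw [mul_add, hc, hd]⟩
      · rintro t a ⟨c, hc⟩
        exact ⟨c, fun s => by rw [← mul_assoc, hc]⟩
    rcases Z.subsingleton_or_nontrivial with hs | hs
    · right
      obtain ⟨o, c, hc⟩ := id hZ
      have hoc : c = o := hs ⟨c, fun s => by rw [← hc o, ← mul_assoc, hc, hc]⟩ ⟨c, hc⟩
      subst hoc
      have hsolve (a : S) (ha : a ≠ c) (b : S) : ∃ s, s * a = b :=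
        (hdich a).resolve_left (fun h' => ha (hs h' ⟨c, hc⟩)) b
      obtain ⟨e, he, hone, hinv⟩ := exists_one_of_forall_exists_mul (p := {x : S | x ≠ c})
        (exists_ne c) fun a ha b hb => by
          obtain ⟨s, rfl⟩ := hsolve a ha b
          exact ⟨s, fun hs' => hb (by rw [hs', mul_comm, hc]), rfl⟩
      refine ⟨c, e, he, fun x => by rw [mul_comm, hc], fun x => ?_, hinv⟩
      by_cases hx : x = c
      · rw [hx, hc]
      · exact hone x hx
    · have hZu : Z = Set.univ := h.2 Z hZI hs
      have hall (a : S) : ∃ c, ∀ s, s * a = c := (hZu ▸ Set.mem_univ a : a ∈ Z)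
      choose c hc using hall
      have hconst (x y : S) : x * y = c (Classical.arbitrary S) := by
        rw [hc y, ← hc y (Classical.arbitrary S), mul_comm, hc]
      have := h.finite_of_mul_const hconst
      exact (not_finite S).elim

end Structure

/-! ### Groups with an absorbing element. -/

namespace IsGroupWithAbsorbing

variable {S : Type u} [CSemiring S] {o e : S} (h : IsGroupWithAbsorbing o e)
include h

theorem mul_absorb (x : S) : x * o = o := by rw [mul_comm, h.absorb_mul]

theorem mul_one (x : S) : x * e = x := by rw [mul_comm, h.one_mul]

theorem mul_ne {x y : S} (hx : x ≠ o) (hy : y ≠ o) : x * y ≠ o := by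
  intro hxy
  obtain ⟨z, -, hz⟩ := h.exists_inv x hx
  apply hy
  rw [← h.one_mul y, ← hz, mul_comm x, mul_assoc, hxy, h.mul_absorb]

theorem left_ne {x y : S} (hxy : x * y ≠ o) : x ≠ o := fun hx => hxy (by rw [hx, h.absorb_mul])

theorem right_ne {x y : S} (hxy : x * y ≠ o) : y ≠ o := fun hy => hxy (by rw [hy, h.mul_absorb])

theorem absorb_add_absorb : o + o = o := by
  have := h.absorb_mul (e + e)
  rwa [mul_add, h.absorb_mul] at this

/-- The absorbing element is additively neutral or additively absorbing. -/
theorem add_absorb_dichotomy : (∀ x, x + o = x) ∨ ∀ x, x + o = o := by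
  have hmul (x : S) : x + o = x * (e + o) := by rw [mul_add, h.mul_one, h.mul_absorb]
  by_cases hz : e + o = o
  · exact Or.inr fun x => by rw [hmul, hz, h.mul_absorb]
  · left
    -- An invertible multiplicative idempotent is the unit.
    have hsq : (e + o) * (e + o) = e + o := by
      rw [← hmul, add_assoc, h.absorb_add_absorb]
    obtain ⟨y, -, hy⟩ := h.exists_inv _ hz
    have he : e + o = e := by
      have := congrArg (· * y) hsq
      simp only [mul_assoc, hy] at this
      rwa [h.mul_one] at this
    exact fun x => by rw [hmul, he, h.mul_one]

theorem addIdempotent (he : e + e = e) : AddIdempotent S := fun x => by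
  have := add_mul e e x
  rwa [he, h.one_mul, eq_comm] at this

/-- The group of elements different from the absorbing one. -/
@[reducible]
noncomputable def group : CommGroup {x : S // x ≠ o} where
  mul a b := ⟨a.1 * b.1, h.mul_ne a.2 b.2⟩
  one := ⟨e, h.one_ne⟩
  inv a := ⟨(h.exists_inv a.1 a.2).choose, (h.exists_inv a.1 a.2).choose_spec.1⟩
  mul_assoc a b c := Subtype.ext (mul_assoc a.1 b.1 c.1)
  mul_comm a b := Subtype.ext (mul_comm a.1 b.1)
  one_mul a := Subtype.ext (h.one_mul a.1)
  mul_one a := Subtype.ext (h.mul_one a.1)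
  inv_mul_cancel a := Subtype.ext
    ((mul_comm _ _).trans (h.exists_inv a.1 a.2).choose_spec.2)

end IsGroupWithAbsorbing

/-! ### Finitely generated fields are finite. -/

section FiniteFields

/-- Nonzero primes are maximal; for the zero ideal, `x * x + 1` being a unit forces `x = 0`. -/
theorem isJacobsonRing_int : IsJacobsonRing ℤ := by
  refine isJacobsonRing_iff_prime_eq.mpr fun P hP => ?_
  by_cases hbot : P = ⊥
  · subst hbot
    refine eq_bot_iff.mpr fun x hx => ?_
    have hunit := Ideal.mem_jacobson_bot.mp hx x
    rw [Int.isUnit_iff] at hunit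
    have h0 : x = 0 := by
      rcases hunit with h | h <;> nlinarith [mul_self_nonneg x]
    rw [h0]
    exact Ideal.zero_mem _
  · have := hP.isMaximal hbot
    exact Ideal.jacobson_eq_self_of_isMaximal

/-- A field that is finitely generated as a ring is finite. -/
theorem finite_of_finiteType_int (K : Type*) [Field K] [Algebra.FiniteType ℤ K] : Finite K := by
  have := isJacobsonRing_int
  have hfin : Module.Finite ℤ K := finite_of_finite_type_of_isJacobsonRing ℤ K
  -- By the Nullstellensatz over ℤ, `K` is a finite ℤ-module. In characteristic zero integrality
  -- would make ℤ a field; otherwise `K` is a finitely generated torsion module.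
  by_cases hinj : Function.Injective (algebraMap ℤ K)
  · have : Algebra.IsIntegral ℤ K := inferInstance
    exact (Int.not_isField (isField_of_isIntegral_of_isField hinj (Field.toIsField K))).elim
  · obtain ⟨n, hn, hn0⟩ : ∃ n : ℤ, algebraMap ℤ K n = 0 ∧ n ≠ 0 := by
      by_contra! hcon
      exact hinj ((injective_iff_map_eq_zero _).mpr hcon)
    refine Module.finite_of_fg_torsion K fun {x} => ⟨⟨n, mem_nonZeroDivisors_of_ne_zero hn0⟩, ?_⟩
    change n • x = 0
    rw [Algebra.smul_def, hn, zero_mul]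

variable {S : Type u} [CSemiring S] {o e : S}

/-- A finitely generated semifield with zero in which `1` has a negative is finite. -/
theorem IsGroupWithAbsorbing.finite_of_neg (h : IsGroupWithAbsorbing o e) (hS : FinGen S)
    (hzero : ∀ x, x + o = x) {n : S} (hn : e + n = o) : Finite S := by
  classical
  let : Field S :=
    { (inferInstance : CSemiring S) with
      zero := o
      one := e
      zero_add := fun a => (add_comm o a).trans (hzero a)
      add_zero := hzero
      nsmul := @nsmulRec S ⟨o⟩ _
      zero_mul := h.absorb_mul
      mul_zero := h.mul_absorb
      one_mul := h.one_mul
      mul_one := h.mul_one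
      neg := fun a => n * a
      zsmul := @zsmulRec S ⟨o⟩ _ ⟨fun a => n * a⟩ (@nsmulRec S ⟨o⟩ _)
      neg_add_cancel := fun a => by
        change n * a + a = o
        nth_rewrite 2 [← h.one_mul a]
        rw [← add_mul, add_comm, hn, h.absorb_mul]
      inv := fun a => if ha : a = o then o else (h.exists_inv a ha).choose
      exists_pair_ne := ⟨e, o, h.one_ne⟩
      mul_inv_cancel := fun a ha => by
        change a * (if ha : a = o then o else (h.exists_inv a ha).choose) = e
        rw [dif_neg (show ¬ a = o from ha)]
        exact (h.exists_inv a ha).choose_spec.2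
      inv_zero := dif_pos rfl
      nnqsmul := _
      nnqsmul_def := fun _ _ => rfl
      qsmul := _
      qsmul_def := fun _ _ => rfl }
  obtain ⟨A, hA, hgen⟩ := hS
  have : Algebra.FiniteType ℤ S := by
    refine ⟨⟨hA.toFinset, ?_⟩⟩
    rw [hA.coe_toFinset, eq_top_iff]
    rintro x -
    induction hgen x with
    | of ha => exact Algebra.subset_adjoin ha
    | add _ _ iha ihb => exact add_mem iha ihb
    | mul _ _ iha ihb => exact mul_mem iha ihb
  exact finite_of_finiteType_int S

end FiniteFields


/-- The elements of a subgroup that lie in a finitely generated submonoid of a commutative group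
form a finitely generated monoid. -/
theorem fg_closure_inf_subgroup {G : Type*} [CommGroup G] {A : Set G} (hA : A.Finite)
    (H : Subgroup G) : (Submonoid.closure A ⊓ H.toSubmonoid).FG := by
  have := hA.fintype
  let f : (A → ℕ) →+ Additive G :=
    { toFun := fun n => Additive.ofMul (∏ a : A, a.1 ^ n a)
      map_zero' := by simp
      map_add' := fun m n => by
        rw [← ofMul_mul, ← Finset.prod_mul_distrib]
        simp only [Pi.add_apply, pow_add] }
  have hf (n : A → ℕ) : (f n).toMul = ∏ a : A, a.1 ^ n a := rfl
  -- The exponent vectors landing in `H` form a subtractive submonoid of ℕ^A: if `m` and `m + n`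
  -- belong to it, so does `n`. Such submonoids are finitely generated.
  have hP : ((Subgroup.toAddSubgroup H).toAddSubmonoid.comap f).FG := by
    refine AddSubmonoid.fg_of_subtractive fun m hm n hmn => ?_
    change f (m + n) ∈ Subgroup.toAddSubgroup H at hmn
    change f m ∈ Subgroup.toAddSubgroup H at hm
    rw [map_add] at hmn
    exact (AddSubgroup.add_mem_cancel_left _ hm).mp hmn
  rw [Submonoid.fg_iff_add_fg]
  convert hP.map f using 1
  ext x
  constructor
  · rintro ⟨hx, hxH⟩
    rw [← Subtype.range_coe (s := A)] at hx
    obtain ⟨n, hn⟩ := Submonoid.mem_closure_range_iff_of_fintype.mp hx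
    exact ⟨n, (show (f n).toMul ∈ H by rw [hf, ← hn]; exact hxH), hn.symm⟩
  · rintro ⟨n, hn, rfl⟩
    refine ⟨?_, hn⟩
    exact prod_mem fun a _ => pow_mem (Submonoid.subset_closure a.2) _

/-! ### The additively neutral case. -/

namespace IsGroupWithAbsorbing

variable {S : Type u} [CSemiring S] {o e : S} (h : IsGroupWithAbsorbing o e)
include h

/-- The case of a semifield with zero. -/
theorem addIdempotent_of_zero [Infinite S] (hC : StatementC.{u}) (hS : FinGen S)
    (hzero : ∀ x, x + o = x) : AddIdempotent S := by
  by_cases hneg : ∃ n, e + n = o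
  · obtain ⟨n, hn⟩ := hneg
    have := h.finite_of_neg hS hzero hn
    exact (not_finite S).elim
  -- Dividing a relation `x + y = o` by `x` would give a negative of `e`.
  · have hadd (x : S) (hx : x ≠ o) (y : S) (_ : y ≠ o) : x + y ≠ o := fun hxy => by
      obtain ⟨z, -, hz⟩ := h.exists_inv x hx
      exact hneg ⟨z * y, by rw [← hz, mul_comm x, ← mul_add, hxy, h.mul_absorb]⟩
    obtain ⟨A, hA, hgen⟩ := hS
    refine h.addIdempotent (hC.one_add_one (p := {x | x ≠ o}) h.one_ne hadd
      (fun x hx y hy => h.mul_ne hx hy) (fun x _ => h.one_mul x) h.exists_inv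
      (B := A \ {o}) hA.sdiff (fun x hx => hx.2) fun x hx => ?_)
    have key : ∀ x, Generated A x → x = o ∨ Generated (A \ {o}) x := by
      intro x hx
      induction hx with
      | @of a ha => exact or_iff_not_imp_left.mpr fun hao => .of ⟨ha, hao⟩
      | add _ _ iha ihb =>
        rcases iha with rfl | ga
        · rwa [add_comm, hzero]
        · rcases ihb with rfl | gb
          · rw [hzero]; exact Or.inr ga
          · exact Or.inr (.add ga gb)
      | mul _ _ iha ihb =>
        rcases iha with rfl | ga
        · exact Or.inl (h.absorb_mul _)
        · rcases ihb with rfl | gb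
          · exact Or.inl (h.mul_absorb _)
          · exact Or.inr (.mul ga gb)
    exact (key x (hgen x)).resolve_left hx

/-! ### The additively absorbing case. -/

section Absorbing

variable (habs : ∀ x, x + o = o)
include habs

omit h in
theorem left_ne_of_add {x y : S} (hxy : x + y ≠ o) : x ≠ o := fun hx => hxy (by
  rw [hx, add_comm, habs])

omit h in
theorem right_ne_of_add {x y : S} (hxy : x + y ≠ o) : y ≠ o := fun hy => hxy (by rw [hy, habs])

/-- If `e + e` is absorbing, then every sum is. -/
theorem add_eq_absorb (h2 : e + e = o) (x y : S) : x + y = o := by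
  have hdouble (x : S) : x + x = o := by
    have := add_mul e e x
    rwa [h2, h.absorb_mul, h.one_mul, eq_comm] at this
  by_contra hxy
  -- The square of `x + y` contains the summand `x * y + x * y = o`, which absorbs the rest.
  refine h.mul_ne hxy hxy ?_
  calc (x + y) * (x + y) = (x * y + x * y) + (x * x + y * y) := by
        rw [add_mul, mul_add, mul_add, mul_comm y x, add_add_add_comm, add_comm (x * x) (x * y),
          add_add_add_comm]
    _ = o := by rw [hdouble, add_comm, habs]

/-- Having a sum different from the absorbing element is a transitive relation. -/
theorem add_ne_trans {x y z : S} (hxy : x + y ≠ o) (hyz : y + z ≠ o) : x + z ≠ o := by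
  have hne := h.mul_ne hxy hyz
  -- A summand of an element different from `o` is different from `o`, and `y * (x + z)` is one
  -- here.
  have hexp : (x + y) * (y + z) = y * (x + z) + (x * z + y * y) := by
    simp only [mul_add, add_mul, mul_comm y x]
    ac_rfl
  rw [hexp] at hne
  exact h.right_ne (left_ne_of_add habs hne)

/-- `w * y + x * z` is a partial sum of `(w + x) * (y + z)`. -/
theorem mul_add_mul_ne {w x y z : S} (hwx : w + x ≠ o) (hyz : y + z ≠ o) :
    w * y + x * z ≠ o := by
  have hne := h.mul_ne hwx hyz
  have hexp : (w + x) * (y + z) = (w * y + x * z) + (w * z + x * y) := by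
    simp only [mul_add, add_mul]
    ac_rfl
  rw [hexp] at hne
  exact left_ne_of_add habs hne

omit habs in
theorem add_self_ne (h2 : e + e ≠ o) {x : S} (hx : x ≠ o) : x + x ≠ o := by
  have := h.mul_ne h2 hx
  rwa [add_mul, h.one_mul] at this

/-- `x + (x + y)` is a partial sum of the double of `x + y`. -/
theorem add_add_left_ne (h2 : e + e ≠ o) {x y : S} (hxy : x + y ≠ o) : x + (x + y) ≠ o := by
  have hne := h.add_self_ne h2 hxy
  rw [add_add_add_comm, ← add_assoc, add_assoc x x y] at hne
  exact left_ne_of_add habs hne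

/-- The elements whose sum with the unit is not absorbing, as a subgroup. -/
def summableSubgroup (h2 : e + e ≠ o) : @Subgroup {x : S // x ≠ o} h.group.toGroup :=
  letI := h.group
  { carrier := {x | e + x.1 ≠ o}
    mul_mem' := fun {x y} hx hy => by
      have := h.mul_add_mul_ne habs hx hy
      rwa [h.one_mul] at this
    one_mem' := h2
    inv_mem' := fun {x} hx => by
      have hx' : x.1 * (x⁻¹).1 = e := congrArg Subtype.val (mul_inv_cancel x)
      have := h.mul_ne hx (x⁻¹).2
      rwa [add_mul, h.one_mul, hx', add_comm] at this }

/-- An element different from `o` is a sum of monomials in the generators, each of which has with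
it a sum different from `o`. -/
theorem mem_closure_of_generated (h2 : e + e ≠ o) {A : Set S} {M : Set S}
    (hAM : ∀ a ∈ A, a ≠ o → a ∈ M) (hM : ∀ a ∈ M, ∀ b ∈ M, a * b ∈ M) {x : S}
    (hx : Generated A x) (hxo : x ≠ o) :
    x ∈ AddSubsemigroup.closure {m | m ∈ M ∧ m + x ≠ o} := by
  induction hx with
  | of ha => exact AddSubsemigroup.subset_closure ⟨hAM _ ha hxo, h.add_self_ne h2 hxo⟩
  | @add a b _ _ iha ihb =>
    have ha := left_ne_of_add habs hxo
    have hb := right_ne_of_add habs hxo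
    have haab : a + (a + b) ≠ o := h.add_add_left_ne habs h2 hxo
    have hbab : b + (a + b) ≠ o := h.add_ne_trans habs (add_comm a b ▸ hxo) haab
    refine add_mem (AddSubsemigroup.closure_mono ?_ (iha ha))
      (AddSubsemigroup.closure_mono ?_ (ihb hb))
    · exact fun m hm => ⟨hm.1, h.add_ne_trans habs hm.2 haab⟩
    · exact fun m hm => ⟨hm.1, h.add_ne_trans habs hm.2 hbab⟩
  | @mul a b _ _ iha ihb =>
    refine AddSubsemigroup.closure_induction (p := fun s _ => s * b ∈ _) ?_ ?_
      (iha (h.left_ne hxo))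
    · intro m hm
      refine AddSubsemigroup.closure_induction (p := fun t _ => m * t ∈ _) ?_ ?_
        (ihb (h.right_ne hxo))
      · exact fun n hn => AddSubsemigroup.subset_closure
          ⟨hM _ hm.1 _ hn.1, h.mul_add_mul_ne habs hm.2 hn.2⟩
      · intro s t _ _ hs ht
        rw [mul_add]
        exact add_mem hs ht
    · intro s t _ _ hs ht
      rw [add_mul]
      exact add_mem hs ht

/-- The case where `o` is additively absorbing but not every sum is `o`. -/
theorem addIdempotent_of_absorbing (hC : StatementC.{u}) (hS : FinGen S) (h2 : e + e ≠ o) :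
    AddIdempotent S := by
  let := h.group
  obtain ⟨A, hA, hgen⟩ := hS
  let H := h.summableSubgroup habs h2
  have hAT : (Subtype.val ⁻¹' A : Set {x : S // x ≠ o}).Finite :=
    hA.preimage Subtype.val_injective.injOn
  -- `B` generates the monomials in the generators that lie in `H`. The unit is adjoined to it below
  -- because the empty product is not a semiring expression.
  obtain ⟨B, hB, hBfin⟩ := (Submonoid.fg_iff _).mp (fg_closure_inf_subgroup hAT H)
  have hmemH (x : {x : S // x ≠ o}) : x ∈ H ↔ e + x.1 ≠ o := Iff.rfl
  have hinv (x : S) (hx : e + x ≠ o) : ∃ y, e + y ≠ o ∧ x * y = e := by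
    let x' : {x : S // x ≠ o} := ⟨x, right_ne_of_add habs hx⟩
    exact ⟨(x'⁻¹).1, (hmemH _).mp (H.inv_mem ((hmemH x').mpr hx)),
      congrArg Subtype.val (mul_inv_cancel x')⟩
  refine h.addIdempotent (hC.one_add_one (p := {x | e + x ≠ o}) h2 ?_ ?_
    (fun x _ => h.one_mul x) hinv (B := insert e (Subtype.val '' B))
    ((hBfin.image _).insert e) ?_ ?_)
  · intro x hx y hy
    have hxy : x + y ≠ o := h.add_ne_trans habs (add_comm e x ▸ hx) hy
    have hxxy : x + (x + y) ≠ o := h.add_add_left_ne habs h2 hxy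
    exact h.add_ne_trans habs hx hxxy
  · intro x hx y hy
    have := h.mul_add_mul_ne habs hx hy
    rwa [h.one_mul] at this
  · rintro _ (rfl | ⟨b, hb, rfl⟩)
    · exact h2
    · have : b ∈ Submonoid.closure B := Submonoid.subset_closure hb
      rw [hB] at this
      exact this.2
  · intro x hx
    let M : Set S := Subtype.val ''
      (Submonoid.closure (Subtype.val ⁻¹' A : Set {x : S // x ≠ o}) : Set {x : S // x ≠ o})
    have hmem := h.mem_closure_of_generated habs h2 (A := A) (M := M)
      (fun a ha hao => ⟨⟨a, hao⟩, Submonoid.subset_closure ha, rfl⟩)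
      (by
        rintro _ ⟨a, ha, rfl⟩ _ ⟨b, hb, rfl⟩
        exact ⟨a * b, mul_mem ha hb, rfl⟩) (hgen x) (right_ne_of_add habs hx)
    refine AddSubsemigroup.closure_induction (p := fun s _ => Generated _ s) ?_
      (fun _ _ _ _ hs ht => .add hs ht) hmem
    rintro _ ⟨⟨m, hm, rfl⟩, hmx⟩
    -- Each monomial `m` of `x` is summable with `x`, and `x` with `e`, so transitivity puts `m` in
    -- `H`.
    have hmH : m ∈ Submonoid.closure B := by
      rw [hB]
      refine ⟨hm, (hmemH m).mpr (h.add_ne_trans habs hx ?_)⟩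
      rwa [add_comm]
    refine Submonoid.closure_induction
      (motive := fun (s : {x : S // x ≠ o}) _ => Generated (insert e (Subtype.val '' B)) s.1)
      ?_ ?_ ?_ hmH
    · exact fun b hb => .of (Or.inr ⟨b, hb, rfl⟩)
    · exact .of (Or.inl rfl)
    · exact fun _ _ _ _ hs ht => .mul hs ht

omit habs in
/-- The case where every sum is `o`. -/
theorem exists_mulEquiv_U [Infinite S] (hS : FinGen S) (hadd : ∀ x y : S, x + y = o) :
    ∃ (G : Type u) (_ : CommGroup G), Infinite G ∧ Group.FG G ∧ Nonempty (S ≃+* U G) := by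
  classical
  let := h.group
  refine ⟨{x : S // x ≠ o}, inferInstance, ?_, ?_, ⟨?_⟩⟩
  · exact Set.infinite_coe_iff.mpr (Set.finite_singleton o).infinite_compl
  · obtain ⟨A, hA, hgen⟩ := hS
    refine Group.fg_iff.mpr ⟨Subtype.val ⁻¹' A, ?_, hA.preimage Subtype.val_injective.injOn⟩
    have key : ∀ x, Generated A x → ∀ hx : x ≠ o,
        (⟨x, hx⟩ : {x : S // x ≠ o}) ∈ Subgroup.closure (Subtype.val ⁻¹' A) := by
      intro x hgx
      induction hgx with
      | of ha => exact fun hx => Subgroup.subset_closure ha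
      -- Sums are all `o`, so elements of the group are pure monomials in the generators.
      | add _ _ _ _ => exact fun hx => absurd (hadd _ _) hx
      | mul _ _ iha ihb =>
        exact fun hx => mul_mem (iha (h.left_ne hx)) (ihb (h.right_ne hx))
    exact eq_top_iff.mpr fun x _ => key x.1 (hgen x.1) x.2
  · refine
      { toFun := fun x => if hx : x = o then U.o else U.of ⟨x, hx⟩
        invFun := fun x => match x with
          | U.o => o
          | U.of g => g.1
        left_inv := fun x => ?_
        right_inv := ?_
        map_add' := fun x y => ?_
        map_mul' := fun x y => ?_ }
    · by_cases hx : x = o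
      · simp [hx]
      · simp [hx]
    · rintro (_ | g)
      · simp
      · simp [g.2]
    · by_cases hx : x = o
      · rw [dif_pos hx, dif_pos (by rw [hx, h.absorb_mul])]
        rfl
      · by_cases hy : y = o
        · rw [dif_pos hy, dif_pos (by rw [hy, h.mul_absorb]), dif_neg hx]
          rfl
        · rw [dif_neg hx, dif_neg hy, dif_neg (h.mul_ne hx hy)]
          rfl
    · rw [dif_pos (hadd x y)]
      rfl

end Absorbing

end IsGroupWithAbsorbing

theorem StatementC.statementC1 (hC : StatementC.{u}) : StatementC1.{u} := by
  intro S _ hS hinf hsimple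
  rcases hsimple.isParasemifield_or with hp | ⟨o, e, h⟩
  · exact Or.inl (hC S hp hS)
  · rcases h.add_absorb_dichotomy with hzero | habs
    · exact Or.inl (h.addIdempotent_of_zero hC hS hzero)
    · by_cases h2 : e + e = o
      · exact Or.inr (h.exists_mulEquiv_U hS (h.add_eq_absorb habs h2))
      · exact Or.inl (h.addIdempotent_of_absorbing habs hC hS h2)

end DivSemiring

open DivSemiring in
theorem proposition8p1 :
    (DivSemiring.StatementA.{u} ↔ DivSemiring.StatementA1.{u}) ∧
    (DivSemiring.StatementA1.{u} → DivSemiring.StatementB.{u}) ∧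
    (DivSemiring.StatementB.{u} ↔ DivSemiring.StatementB1.{u}) ∧
    (DivSemiring.StatementB1.{u} ↔ DivSemiring.StatementB2.{u}) ∧
    (DivSemiring.StatementB2.{u} → DivSemiring.StatementC.{u}) ∧
    (DivSemiring.StatementC.{u} ↔ DivSemiring.StatementC1.{u}) :=
  ⟨statementA_iff_statementA1, StatementA1.statementB, statementB_iff_statementB1,
    statementB1_iff_statementB2, StatementB2.statementC,
    StatementC.statementC1, StatementC1.statementC⟩
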